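/- For a real number $t$ let $\sqrt[3]{t}$ denote its real cube root (so $\sqrt[3]{-t}=-\sqrt[3]{t}$), and let $\log$ be the natural logarithm. Let $x,y$ be real numbers with $y\ne 0$ and either $$\frac{x}{y}>1\qquad\text{or}\qquad \frac{x}{y}<-(\sqrt2+1)^2 .$$ Then the series below converges (absolutely) and $$ \begin{aligned} \sum_{k=1}^\infty\frac{(27xy)^k}{(x+y)^{2k}\binom{3k}{k}} ={}&\frac{4xy}{(x-y)^2} +\frac{\sqrt[3]{xy}}{3}\,\frac{x+y}{(x-y)^3}\Bigg( 2\sqrt3\Big(2\sqrt[3]{xy}\,\big(\sqrt[3]{x^2}+\sqrt[3]{y^2}\big)+\sqrt[3]{x^4}+\sqrt[3]{y^4}\Big) \arctan\bigg(\frac{\sqrt3\,\sqrt[3]{y}}{2\sqrt[3]{x}-\sqrt[3]{y}}\bigg)\\ &-\Big(2\sqrt[3]{xy}\,\big(\sqrt[3]{x^2}-\sqrt[3]{y^2}\big)-\sqrt[3]{x^4}+\sqrt[3]{y^4}\Big) \log\bigg(\frac{x+y}{\big(\sqrt[3]{x}+\sqrt[3]{y}\big)^3}\bigg)\Bigg).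 \end{aligned} $$ -/

import Mathlib

/-- The real (odd) cube root: `cbrt x` is the unique real `c` with `c ^ 3 = x`,
also for negative `x`. -/
noncomputable def cbrt (x : ℝ) : ℝ := (SignType.sign x : ℝ) * |x| ^ (1 / 3 : ℝ)

theorem cbrt_pow_three (x : ℝ) : cbrt x ^ 3 = x := by
  have h : (|x| ^ (1 / 3 : ℝ)) ^ 3 = |x| := by
    rw [← Real.rpow_natCast, ← Real.rpow_mul (abs_nonneg x)]
    norm_num
  rcases lt_trichotomy x 0 with hx | hx | hx
  · rw [cbrt, mul_pow, h, sign_neg hx, abs_of_neg hx]; norm_num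
  · subst hx; simp [cbrt]
  · rw [cbrt, mul_pow, h, sign_pos hx, abs_of_pos hx]; norm_num

theorem eq_cbrt_iff (c x : ℝ) : c = cbrt x ↔ c ^ 3 = x := by
  constructor
  · rintro rfl; exact cbrt_pow_three x
  · intro h
    have hodd : Odd 3 := by decide
    exact (hodd.strictMono_pow (R := ℝ)).injective (by simpa [cbrt_pow_three] using h)

/-! Writing 1 / C(3k, k) as k times a Beta integral and summing under the integral sign turns the
series in z into ∫₀¹ z(1-u)² / (1 - zu(1-u)²)² du (`hasSum_pow_div_choose`). For z = 27t³/(1+t³)²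
with t = ∛(x/y), the cubic in the denominator has an explicit linear factor over ℝ. Hermite
reduction then gives an antiderivative made of a rational function, logarithms and one arctangent,
and its endpoint values yield the closed form (`integral_eq`). Homogeneity in x and y does the rest.
-/

/-! ### Beta integrals and the integral form of the series. -/

open intervalIntegral in
/-- The Beta integral at natural numbers. -/
theorem integral_pow_mul_one_sub_pow (m n : ℕ) :
    ∫ u in (0 : ℝ)..1, u ^ m * (1 - u) ^ n =
      (m.factorial * n.factorial : ℝ) / (m + n + 1).factorial := by
  induction n generalizing m with
  | zero =>
    simp only [pow_zero, mul_one, integral_pow, Nat.factorial_zero, Nat.cast_one, add_zero,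
      Nat.factorial_succ, Nat.cast_mul]
    have := Nat.factorial_ne_zero m
    field_simp
    simp
  | succ n ih =>
    -- Integration by parts: this product vanishes at both endpoints, which ties the exponents (m, n
    -- + 1) to (m + 1, n).
    have hd : ∀ u ∈ Set.uIcc (0 : ℝ) 1, HasDerivAt (fun u : ℝ => u ^ (m + 1) * (1 - u) ^ (n + 1))
        ((m + 1) * (u ^ m * (1 - u) ^ (n + 1)) - (n + 1) * (u ^ (m + 1) * (1 - u) ^ n)) u := by
      intro u _
      have h := (hasDerivAt_pow (m + 1) u).mul
        (((hasDerivAt_id u).const_sub 1).pow (n + 1))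
      refine h.congr_deriv ?_
      simp
      ring
    have h := integral_eq_sub_of_hasDerivAt hd (Continuous.intervalIntegrable (by fun_prop) _ _)
    rw [integral_sub (Continuous.intervalIntegrable (by fun_prop) _ _)
      (Continuous.intervalIntegrable (by fun_prop) _ _), integral_const_mul, integral_const_mul,
      ih (m + 1)] at h
    have e : m + (n + 1) + 1 = m + 1 + n + 1 := by ring
    rw [e]
    have h1 := Nat.factorial_ne_zero (m + 1 + n + 1)
    simp only [ne_eq, Nat.add_eq_zero_iff, one_ne_zero, and_false, not_false_eq_true, zero_pow,
      sub_self, mul_zero, zero_mul] at h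
    have h2 : (m + 1 : ℝ) ≠ 0 := by positivity
    have h3 : (((m + 1).factorial : ℕ) : ℝ) = (m + 1) * m.factorial := by
      push_cast [Nat.factorial_succ]; ring
    have h4 : (((n + 1).factorial : ℕ) : ℝ) = (n + 1) * n.factorial := by
      push_cast [Nat.factorial_succ]; ring
    rw [h3] at h
    rw [h4]
    apply mul_left_cancel₀ h2
    linear_combination h

theorem integral_eq_inv_choose (k : ℕ) :
    ∫ u in (0 : ℝ)..1, (k + 1) * (u ^ k * (1 - u) ^ (2 * (k + 1))) =
      1 / ((3 * (k + 1)).choose (k + 1) : ℝ) := by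
  rw [intervalIntegral.integral_const_mul, integral_pow_mul_one_sub_pow,
    Nat.cast_choose ℝ (by lia : k + 1 ≤ 3 * (k + 1)),
    show 3 * (k + 1) - (k + 1) = 2 * (k + 1) by lia,
    show k + 2 * (k + 1) + 1 = 3 * (k + 1) by ring, Nat.factorial_succ k]
  push_cast
  have h1 := Nat.factorial_ne_zero (3 * (k + 1))
  have h2 := Nat.factorial_ne_zero (2 * (k + 1))
  have h3 := Nat.factorial_ne_zero k
  field_simp

/-- The difference of the two sides is (u - 1/3)²(4/3 - u). The maximum 4/27 is what makes 27/4 the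
radius of convergence. -/
theorem mul_one_sub_sq_le {u : ℝ} (hu : u ≤ 1) : u * (1 - u) ^ 2 ≤ 4 / 27 := by
  nlinarith [mul_nonneg (sub_nonneg.2 hu) (sq_nonneg (u - 1 / 3)), sq_nonneg (u - 1 / 3)]

theorem abs_mul_mul_one_sub_sq_lt_one {z u : ℝ} (hz : |z| < 27 / 4) (h0 : 0 ≤ u) (h1 : u ≤ 1) :
    |z * (u * (1 - u) ^ 2)| < 1 := by
  rw [abs_mul, abs_of_nonneg (by positivity : 0 ≤ u * (1 - u) ^ 2)]
  have h := mul_one_sub_sq_le h1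
  nlinarith [abs_nonneg z]

/-- The series of the reciprocals of `(3k).choose k` as the integral of a rational function. -/
theorem hasSum_pow_div_choose {z : ℝ} (hz : |z| < 27 / 4) :
    HasSum (fun k : ℕ => z ^ (k + 1) / ((3 * (k + 1)).choose (k + 1) : ℝ))
      (∫ u in (0 : ℝ)..1, z * (1 - u) ^ 2 / (1 - z * (u * (1 - u) ^ 2)) ^ 2) := by
  have hq : |z| * (4 / 27) < 1 := by linarith
  have hsum : Summable fun k : ℕ => |z| * ((k + 1) * (|z| * (4 / 27)) ^ k) := by
    have hn : ‖|z| * (4 / 27)‖ < 1 := by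
      rw [Real.norm_of_nonneg (by positivity)]; exact hq
    refine Summable.mul_left _ ?_
    simp only [add_mul, one_mul]
    exact (hasSum_coe_mul_geometric_of_norm_lt_one hn).summable.add
      (summable_geometric_of_norm_lt_one hn)
  have key := intervalIntegral.hasSum_integral_of_dominated_convergence
    (μ := MeasureTheory.volume) (a := 0) (b := 1)
    (F := fun (k : ℕ) (u : ℝ) => z ^ (k + 1) * ((k + 1) * (u ^ k * (1 - u) ^ (2 * (k + 1)))))
    (f := fun u => z * (1 - u) ^ 2 / (1 - z * (u * (1 - u) ^ 2)) ^ 2)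
    (fun k _ => |z| * ((k + 1) * (|z| * (4 / 27)) ^ k))
    (fun k => Continuous.aestronglyMeasurable (by fun_prop)) ?_ ?_ ?_ ?_
  · convert! key using 1
    ext k
    rw [intervalIntegral.integral_const_mul, integral_eq_inv_choose, mul_one_div]
  · intro k
    refine Filter.Eventually.of_forall fun u hu => ?_
    rw [Set.uIoc_of_le zero_le_one] at hu
    have e : z ^ (k + 1) * ((k + 1) * (u ^ k * (1 - u) ^ (2 * (k + 1)))) =
        z * ((k + 1) * ((z * (u * (1 - u) ^ 2)) ^ k * (1 - u) ^ 2)) := by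
      rw [mul_pow, mul_pow, pow_mul]; ring
    rw [e, Real.norm_eq_abs, abs_mul, abs_mul, abs_mul, abs_pow, abs_mul z,
      abs_of_nonneg (by positivity : (0 : ℝ) ≤ k + 1), abs_of_nonneg (sq_nonneg (1 - u)),
      abs_of_nonneg (mul_nonneg hu.1.le (sq_nonneg (1 - u)))]
    have h := mul_one_sub_sq_le hu.2
    have hb : (1 - u) ^ 2 ≤ 1 := by nlinarith [hu.1, hu.2]
    have hu0 := hu.1.le
    calc |z| * ((k + 1) * ((|z| * (u * (1 - u) ^ 2)) ^ k * (1 - u) ^ 2))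
        ≤ |z| * ((k + 1) * ((|z| * (4 / 27)) ^ k * 1)) := by gcongr
      _ = _ := by ring
  · exact Filter.Eventually.of_forall fun _ _ => hsum
  · exact intervalIntegrable_const
  · refine Filter.Eventually.of_forall fun u hu => ?_
    rw [Set.uIoc_of_le zero_le_one] at hu
    have hw := abs_mul_mul_one_sub_sq_lt_one hz hu.1.le hu.2
    set w := z * (u * (1 - u) ^ 2) with hw'
    have hw1 : 1 - w ≠ 0 := by linarith [(abs_lt.1 hw).2]
    -- ∑ (k + 1)wᵏ is split as ∑ k wᵏ + ∑ wᵏ.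
    have h := ((hasSum_coe_mul_geometric_of_norm_lt_one (r := w) hw).add
      (hasSum_geometric_of_norm_lt_one (ξ := w) hw)).mul_left (z * (1 - u) ^ 2)
    have e : z * (1 - u) ^ 2 * (w / (1 - w) ^ 2 + (1 - w)⁻¹) = z * (1 - u) ^ 2 / (1 - w) ^ 2 := by
      field_simp
      ring
    rw [e] at h
    convert! h using 1
    ext k
    rw [hw', mul_pow, mul_pow, pow_mul]
    ring

/-! ### Arctangent identities for the endpoint values. -/

/-- The addition formula is applied twice, through (t - 2)/(√3 t). Since |t| > 1, both products of
arguments stay below 1, so no multiple of π appears. -/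
theorem arctan_left_endpoint {t : ℝ} (ht : 1 < t ∨ t < -1) :
    Real.arctan ((t ^ 2 - 4 * t + 1) / (√3 * (t ^ 2 - 1))) =
      Real.arctan (1 / √3) - 2 * Real.arctan (√3 / (2 * t - 1)) := by
  have h3 : √3 ^ 2 = (3 : ℝ) := Real.sq_sqrt (by norm_num)
  have h30 : √3 ≠ 0 := by positivity
  have hp : 0 < t * (2 * t - 1) := by rcases ht with h | h <;> nlinarith
  have hp1 : 0 < t ^ 2 - 1 := by rcases ht with h | h <;> nlinarith
  have ht0 : t ≠ 0 := left_ne_zero_of_mul hp.ne'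
  have ht1 : 2 * t - 1 ≠ 0 := right_ne_zero_of_mul hp.ne'
  have e1 : Real.arctan (1 / √3) + Real.arctan (-(√3 / (2 * t - 1))) =
      Real.arctan ((t - 2) / (√3 * t)) := by
    have e : 1 / √3 * -(√3 / (2 * t - 1)) = -(t / (t * (2 * t - 1))) := by field_simp
    have hl : -(t / (t * (2 * t - 1))) < 1 := by
      rw [← neg_div, div_lt_one hp]
      rcases ht with h | h <;> nlinarith
    rw [Real.arctan_add (by rw [e]; exact hl), e]
    congr 1
    have : 1 - -(t / (t * (2 * t - 1))) ≠ 0 := by linarith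
    rw [div_eq_div_iff this (by positivity)]
    field_simp
    rw [h3]; ring
  have e2 : Real.arctan ((t - 2) / (√3 * t)) + Real.arctan (-(√3 / (2 * t - 1))) =
      Real.arctan ((t ^ 2 - 4 * t + 1) / (√3 * (t ^ 2 - 1))) := by
    have e : (t - 2) / (√3 * t) * -(√3 / (2 * t - 1)) = -((t - 2) / (t * (2 * t - 1))) := by
      field_simp
    have hl : -((t - 2) / (t * (2 * t - 1))) < 1 := by
      rw [← neg_div, div_lt_one hp]; nlinarith
    rw [Real.arctan_add (by rw [e]; exact hl), e]
    congr 1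
    have e3 : 1 - -((t - 2) / (t * (2 * t - 1))) = 2 * (t ^ 2 - 1) / (t * (2 * t - 1)) := by
      rw [sub_neg_eq_add, eq_div_iff hp.ne', add_mul, div_mul_cancel₀ _ hp.ne']; ring
    have e4 : (t - 2) / (√3 * t) + -(√3 / (2 * t - 1)) =
        2 * (t ^ 2 - 4 * t + 1) / (√3 * (t * (2 * t - 1))) := by
      rw [← sub_eq_add_neg, div_sub_div _ _ (by positivity) ht1,
        div_eq_div_iff (by positivity) (by positivity)]
      linear_combination (-√3 * t ^ 2 * (2 * t - 1)) * h3
    rw [e3, e4, div_div_div_eq, div_eq_div_iff (by positivity) (by positivity)]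
    ring
  rw [Real.arctan_neg] at e1 e2
  linarith

theorem arctan_right_endpoint {t : ℝ} (ht : 1 < t ∨ t < -1) :
    Real.arctan ((t + 1) ^ 2 / (√3 * (t ^ 2 - 1))) =
      Real.arctan (1 / √3) + Real.arctan (√3 / (2 * t - 1)) := by
  have h3 : √3 ^ 2 = (3 : ℝ) := Real.sq_sqrt (by norm_num)
  have h30 : √3 ≠ 0 := by positivity
  have hp1 : 0 < t ^ 2 - 1 := by rcases ht with h | h <;> nlinarith
  have hp : 0 < t * (2 * t - 1) := by rcases ht with h | h <;> nlinarith
  have ht1 : 2 * t - 1 ≠ 0 := right_ne_zero_of_mul hp.ne'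
  have e : 1 / √3 * (√3 / (2 * t - 1)) = t / (t * (2 * t - 1)) := by
    have := left_ne_zero_of_mul hp.ne'
    field_simp
  have hl : t / (t * (2 * t - 1)) < 1 := by
    rw [div_lt_one hp]; rcases ht with h | h <;> nlinarith
  rw [Real.arctan_add (by rw [e]; exact hl)]
  congr 1
  have e1 : 1 - 1 / √3 * (√3 / (2 * t - 1)) = 2 * (t - 1) / (2 * t - 1) := by
    have e' : 1 / √3 * (√3 / (2 * t - 1)) = 1 / (2 * t - 1) := by field_simp
    rw [e', one_sub_div ht1]; ring
  have e2 : 1 / √3 + √3 / (2 * t - 1) = 2 * (t + 1) / (√3 * (2 * t - 1)) := by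
    rw [div_add_div _ _ h30 ht1]
    congr 1
    linear_combination h3
  have hm : t - 1 ≠ 0 := by rcases ht with h | h <;> linarith
  rw [e1, e2, div_div_div_eq, div_eq_div_iff (by positivity) (by positivity)]
  ring

/-! ### Factorization of the denominator and the antiderivative. -/

/-- The linear factor of `(1 + t ^ 3) ^ 2 - 27 * t ^ 3 * u * (1 - u) ^ 2` as a polynomial
in `u`. -/
def linearFactor (t u : ℝ) : ℝ := (1 + t) ^ 2 - 3 * t * u

/-- Half the derivative in `u` of `quadraticFactor t u`, divided by `3 * t`. -/
noncomputable def quadraticShift (t u : ℝ) : ℝ := 3 * t * u - 2 * t + (t ^ 2 + 1) / 2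

/-- The quadratic factor of `(1 + t ^ 3) ^ 2 - 27 * t ^ 3 * u * (1 - u) ^ 2` as a polynomial
in `u`. -/
noncomputable def quadraticFactor (t u : ℝ) : ℝ :=
  quadraticShift t u ^ 2 + 3 / 4 * (t ^ 2 - 1) ^ 2

/-- For t ≠ 0 the root u = (1+t)²/(3t) has 1 - u = -(t²-t+1)/(3t), and (1+t)(t²-t+1) = 1+t³. -/
theorem linearFactor_mul_quadraticFactor (t u : ℝ) :
    linearFactor t u * quadraticFactor t u =
      (1 + t ^ 3) ^ 2 - 27 * t ^ 3 * (u * (1 - u) ^ 2) := by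
  unfold linearFactor quadraticFactor quadraticShift; ring

theorem linearFactor_pos {t u : ℝ} (ht : 1 < t ∨ t < -1) (h0 : 0 ≤ u) (h1 : u ≤ 1) :
    0 < linearFactor t u := by
  unfold linearFactor
  rcases ht with h | h <;> nlinarith [mul_self_pos.2 (by linarith : t + 1 ≠ 0)]

theorem quadraticFactor_pos {t : ℝ} (ht : 1 < t ∨ t < -1) (u : ℝ) : 0 < quadraticFactor t u := by
  have : 0 < t ^ 2 - 1 := by rcases ht with h | h <;> nlinarith
  unfold quadraticFactor; positivity

theorem hasDerivAt_linearFactor (t u : ℝ) : HasDerivAt (linearFactor t) (-(3 * t)) u := by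
  have h := ((hasDerivAt_id u).const_mul (3 * t)).const_sub ((1 + t) ^ 2)
  exact h.congr_deriv (by simp)

theorem hasDerivAt_quadraticShift (t u : ℝ) : HasDerivAt (quadraticShift t) (3 * t) u := by
  have h := (((hasDerivAt_id u).const_mul (3 * t)).sub_const (2 * t)).add_const ((t ^ 2 + 1) / 2)
  exact h.congr_deriv (by simp)

theorem hasDerivAt_quadraticFactor (t u : ℝ) :
    HasDerivAt (quadraticFactor t) (6 * t * quadraticShift t u) u := by
  have h := ((hasDerivAt_quadraticShift t u).pow 2).add_const (3 / 4 * (t ^ 2 - 1) ^ 2)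
  refine h.congr_deriv ?_
  norm_num; ring

/-- The rational part of the antiderivative. -/
noncomputable def rationalPart (t u : ℝ) : ℝ :=
  (1 + t ^ 3) ^ 2 * (((t ^ 3) ^ 2 - 10 * t ^ 3 + 1) / 3 + 10 * t ^ 3 * u - 6 * t ^ 3 * u ^ 2) /
    ((t ^ 3 - 1) ^ 2 * (linearFactor t u * quadraticFactor t u))

/-- The logarithmic part of the antiderivative, up to a factor. -/
noncomputable def logPart (t u : ℝ) : ℝ :=
  2 * Real.log (linearFactor t u) - Real.log (quadraticFactor t u)

/-- The arctangent part of the antiderivative, up to a factor. -/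
noncomputable def arctanPart (t u : ℝ) : ℝ :=
  Real.arctan (2 * quadraticShift t u / (√3 * (t ^ 2 - 1)))

/-- Hermite reduction: the rational part absorbs the squared denominator and leaves a remainder over
its first power. -/
theorem hasDerivAt_rationalPart {t u : ℝ} (ht : t ^ 3 - 1 ≠ 0)
    (hL : linearFactor t u ≠ 0) (hM : quadraticFactor t u ≠ 0) :
    HasDerivAt (rationalPart t)
      (27 * t ^ 3 * (1 + t ^ 3) ^ 2 * (1 - u) ^ 2 / (linearFactor t u * quadraticFactor t u) ^ 2 -
        t ^ 3 * (8 - 6 * u) * (1 + t ^ 3) ^ 2 /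
          ((t ^ 3 - 1) ^ 2 * (linearFactor t u * quadraticFactor t u))) u := by
  have hn : HasDerivAt (fun u : ℝ => (1 + t ^ 3) ^ 2 *
      (((t ^ 3) ^ 2 - 10 * t ^ 3 + 1) / 3 + 10 * t ^ 3 * u - 6 * t ^ 3 * u ^ 2))
      ((1 + t ^ 3) ^ 2 * (10 * t ^ 3 - 12 * t ^ 3 * u)) u := by
    have h := ((((hasDerivAt_id u).const_mul (10 * t ^ 3)).const_add
      (((t ^ 3) ^ 2 - 10 * t ^ 3 + 1) / 3)).sub
        (((hasDerivAt_id u).pow 2).const_mul (6 * t ^ 3))).const_mul ((1 + t ^ 3) ^ 2)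
    refine h.congr_deriv ?_
    simp only [id_eq, Nat.cast_ofNat]; ring
  have hd : HasDerivAt (fun u : ℝ => (t ^ 3 - 1) ^ 2 * (linearFactor t u * quadraticFactor t u))
      ((t ^ 3 - 1) ^ 2 * (-(27 * t ^ 3 * (1 - u) * (1 - 3 * u)))) u := by
    refine (((hasDerivAt_linearFactor t u).mul (hasDerivAt_quadraticFactor t u)).const_mul
      ((t ^ 3 - 1) ^ 2)).congr_deriv ?_
    unfold linearFactor quadraticFactor quadraticShift; ring
  refine (hn.div hd (by positivity)).congr_deriv ?_
  have hK := linearFactor_mul_quadraticFactor t u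
  have hK0 := mul_ne_zero hL hM
  set K := linearFactor t u * quadraticFactor t u
  field_simp
  rw [hK]; ring

theorem hasDerivAt_logPart {t u : ℝ} (hL : linearFactor t u ≠ 0) (hM : quadraticFactor t u ≠ 0) :
    HasDerivAt (logPart t)
      (-(6 * t * (quadraticFactor t u + linearFactor t u * quadraticShift t u)) /
        (linearFactor t u * quadraticFactor t u)) u := by
  refine ((((hasDerivAt_linearFactor t u).log hL).const_mul 2).sub
    ((hasDerivAt_quadraticFactor t u).log hM)).congr_deriv ?_
  field_simp
  ring

theorem hasDerivAt_arctanPart {t : ℝ} (ht : 0 < t ^ 2 - 1) (u : ℝ) :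
    HasDerivAt (arctanPart t) (3 * t * √3 * (t ^ 2 - 1) / (2 * quadraticFactor t u)) u := by
  have h3 : √3 ^ 2 = (3 : ℝ) := Real.sq_sqrt (by norm_num)
  refine (((hasDerivAt_quadraticShift t u).const_mul 2).div_const
    (√3 * (t ^ 2 - 1))).arctan.congr_deriv ?_
  have hM : 0 < quadraticFactor t u := by unfold quadraticFactor; positivity
  have e : 1 + (2 * quadraticShift t u / (√3 * (t ^ 2 - 1))) ^ 2 =
      4 * quadraticFactor t u / (3 * (t ^ 2 - 1) ^ 2) := by
    rw [div_pow, mul_pow, mul_pow, h3]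
    unfold quadraticFactor
    field_simp
    ring
  rw [e]
  field_simp
  rw [h3]; ring

/-- Divided by the product of the two factors, this splits the Hermite remainder into multiples of
the derivatives of `logPart` and `arctanPart`. -/
theorem partial_fractions (t u : ℝ) :
    t ^ 3 * (8 - 6 * u) * (1 + t ^ 3) ^ 2 * (t ^ 3 - 1) =
      -(2 / 3 * t ^ 2 * (t + 1) * (t ^ 3 + 1) * (t - 1) ^ 3 *
          (quadraticFactor t u + linearFactor t u * quadraticShift t u)) +
        t ^ 2 * (t ^ 3 + 1) * (t ^ 2 - 1) * (t ^ 4 + 2 * t ^ 3 + 2 * t + 1) *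
          linearFactor t u := by
  unfold linearFactor quadraticFactor quadraticShift; ring

/-- The rational integral that represents the series at `z = 27 t ^ 3 / (1 + t ^ 3) ^ 2`. -/
theorem integral_eq {t : ℝ} (ht : 1 < t ∨ t < -1) :
    ∫ u in (0 : ℝ)..1, 27 * t ^ 3 / (1 + t ^ 3) ^ 2 * (1 - u) ^ 2 /
        (1 - 27 * t ^ 3 / (1 + t ^ 3) ^ 2 * (u * (1 - u) ^ 2)) ^ 2 =
      4 * t ^ 3 / (t ^ 3 - 1) ^ 2 + t / 3 * ((t ^ 3 + 1) / (t ^ 3 - 1) ^ 3) *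
        (2 * √3 * (t ^ 4 + 2 * t ^ 3 + 2 * t + 1) * Real.arctan (√3 / (2 * t - 1)) +
          (t - 1) ^ 3 * (t + 1) * Real.log ((t ^ 3 + 1) / (t + 1) ^ 3)) := by
  have h3 : √3 ^ 2 = (3 : ℝ) := Real.sq_sqrt (by norm_num)
  have hsq : 0 < t ^ 2 - 1 := by rcases ht with h | h <;> nlinarith
  have hp : t + 1 ≠ 0 := by rcases ht with h | h <;> linarith
  have hm : t - 1 ≠ 0 := by rcases ht with h | h <;> linarith
  have hq : 0 < t ^ 2 - t + 1 := by nlinarith [sq_nonneg (t - 1)]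
  have hq' : 0 < t ^ 2 + t + 1 := by nlinarith [sq_nonneg (t + 1)]
  have hp3 : t ^ 3 + 1 = (t + 1) * (t ^ 2 - t + 1) := by ring
  have hp3' : 1 + t ^ 3 ≠ 0 := by rw [add_comm, hp3]; positivity
  have hm3 : t ^ 3 - 1 ≠ 0 := by
    rw [show t ^ 3 - 1 = (t - 1) * (t ^ 2 + t + 1) by ring]; positivity
  -- α and γ are the coefficients in `partial_fractions`, rescaled by the constants in those two
  -- derivatives.
  set α := -(t / 9) * (t + 1) * (t ^ 3 + 1) * (t - 1) ^ 3 / (t ^ 3 - 1) ^ 3 with hα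
  set γ := 2 * √3 / 9 * t * (t ^ 3 + 1) * (t ^ 4 + 2 * t ^ 3 + 2 * t + 1) / (t ^ 3 - 1) ^ 3
    with hγ
  have hd : ∀ u ∈ Set.uIcc (0 : ℝ) 1, HasDerivAt
      (fun u => rationalPart t u - α * logPart t u + γ * arctanPart t u)
      (27 * t ^ 3 / (1 + t ^ 3) ^ 2 * (1 - u) ^ 2 /
        (1 - 27 * t ^ 3 / (1 + t ^ 3) ^ 2 * (u * (1 - u) ^ 2)) ^ 2) u := by
    intro u hu
    rw [Set.uIcc_of_le zero_le_one] at hu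
    have hL := (linearFactor_pos ht hu.1 hu.2).ne'
    have hM := (quadraticFactor_pos ht u).ne'
    refine (((hasDerivAt_rationalPart hm3 hL hM).sub
      ((hasDerivAt_logPart hL hM).const_mul α)).add
      ((hasDerivAt_arctanPart hsq u).const_mul γ)).congr_deriv ?_
    have e1 : 27 * t ^ 3 / (1 + t ^ 3) ^ 2 * (1 - u) ^ 2 /
        (1 - 27 * t ^ 3 / (1 + t ^ 3) ^ 2 * (u * (1 - u) ^ 2)) ^ 2 =
        27 * t ^ 3 * (1 + t ^ 3) ^ 2 * (1 - u) ^ 2 /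
          (linearFactor t u * quadraticFactor t u) ^ 2 := by
      have e : 1 - 27 * t ^ 3 / (1 + t ^ 3) ^ 2 * (u * (1 - u) ^ 2) =
          linearFactor t u * quadraticFactor t u / (1 + t ^ 3) ^ 2 := by
        rw [linearFactor_mul_quadraticFactor]; field_simp
      rw [e]; field_simp
    have e2 : t ^ 3 * (8 - 6 * u) * (1 + t ^ 3) ^ 2 /
          ((t ^ 3 - 1) ^ 2 * (linearFactor t u * quadraticFactor t u)) =
        -(α * (-(6 * t * (quadraticFactor t u + linearFactor t u * quadraticShift t u)) /
          (linearFactor t u * quadraticFactor t u))) +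
        γ * (3 * t * √3 * (t ^ 2 - 1) / (2 * quadraticFactor t u)) := by
      have e3 : t ^ 3 * (8 - 6 * u) * (1 + t ^ 3) ^ 2 /
          ((t ^ 3 - 1) ^ 2 * (linearFactor t u * quadraticFactor t u)) =
          t ^ 3 * (8 - 6 * u) * (1 + t ^ 3) ^ 2 * (t ^ 3 - 1) /
          ((t ^ 3 - 1) ^ 3 * (linearFactor t u * quadraticFactor t u)) := by
        field_simp
      rw [e3, partial_fractions, hα, hγ]
      generalize quadraticShift t u = N
      generalize linearFactor t u = L at hL
      generalize quadraticFactor t u = M at hM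
      field_simp
      rw [h3]
      ring
    rw [e1]
    linarith
  have hint : IntervalIntegrable (fun u : ℝ => 27 * t ^ 3 / (1 + t ^ 3) ^ 2 * (1 - u) ^ 2 /
      (1 - 27 * t ^ 3 / (1 + t ^ 3) ^ 2 * (u * (1 - u) ^ 2)) ^ 2)
      MeasureTheory.volume 0 1 := by
    refine ContinuousOn.intervalIntegrable (ContinuousOn.div (by fun_prop) (by fun_prop) ?_)
    intro u hu
    rw [Set.uIcc_of_le zero_le_one] at hu
    have e : 1 - 27 * t ^ 3 / (1 + t ^ 3) ^ 2 * (u * (1 - u) ^ 2) =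
        linearFactor t u * quadraticFactor t u / (1 + t ^ 3) ^ 2 := by
      rw [linearFactor_mul_quadraticFactor]; field_simp
    have hL := linearFactor_pos ht hu.1 hu.2
    have hM := quadraticFactor_pos ht u
    rw [e]
    positivity
  rw [intervalIntegral.integral_eq_sub_of_hasDerivAt hd hint]
  have hR : rationalPart t 1 - rationalPart t 0 = 4 * t ^ 3 / (t ^ 3 - 1) ^ 2 := by
    simp only [rationalPart, linearFactor_mul_quadraticFactor]
    norm_num
    field_simp
    ring
  have hlog : logPart t 1 - logPart t 0 = 3 * Real.log ((t ^ 3 + 1) / (t + 1) ^ 3) := by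
    have e1 : linearFactor t 1 = t ^ 2 - t + 1 := by unfold linearFactor; ring
    have e2 : linearFactor t 0 = (t + 1) ^ 2 := by unfold linearFactor; ring
    have e3 : quadraticFactor t 1 = (t + 1) ^ 2 * (t ^ 2 - t + 1) := by
      unfold quadraticFactor quadraticShift; ring
    have e4 : quadraticFactor t 0 = (t ^ 2 - t + 1) ^ 2 := by
      unfold quadraticFactor quadraticShift; ring
    have e5 : (t ^ 3 + 1) / (t + 1) ^ 3 = (t ^ 2 - t + 1) / (t + 1) ^ 2 := by
      rw [hp3]; field_simp
    rw [logPart, logPart, e1, e2, e3, e4, e5, Real.log_mul (by positivity) hq.ne',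
      Real.log_div hq.ne' (by positivity), Real.log_pow, Real.log_pow]
    push_cast
    ring
  have hatan : arctanPart t 1 - arctanPart t 0 = 3 * Real.arctan (√3 / (2 * t - 1)) := by
    have e1 : 2 * quadraticShift t 1 = (t + 1) ^ 2 := by unfold quadraticShift; ring
    have e2 : 2 * quadraticShift t 0 = t ^ 2 - 4 * t + 1 := by unfold quadraticShift; ring
    rw [arctanPart, arctanPart, e1, e2, arctan_left_endpoint ht, arctan_right_endpoint ht]
    ring
  have e : rationalPart t 1 - α * logPart t 1 + γ * arctanPart t 1 -
      (rationalPart t 0 - α * logPart t 0 + γ * arctanPart t 0) =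
      (rationalPart t 1 - rationalPart t 0) - α * (logPart t 1 - logPart t 0) +
        γ * (arctanPart t 1 - arctanPart t 0) := by ring
  rw [e, hR, hlog, hatan, hα, hγ]
  ring

/-! ### Convergence domain and return to x and y. -/

/-- With r = t³ the bound reads 4|r| < (1+r)². For r > 1 this is (r-1)² > 0; for r < 0 it is r²+6r+1
> 0, whose smaller root is -(√2+1)². -/
theorem abs_lt_of_cube {t : ℝ} (ht : 1 < t ^ 3 ∨ t ^ 3 < -(√2 + 1) ^ 2) :
    |27 * t ^ 3 / (1 + t ^ 3) ^ 2| < 27 / 4 := by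
  have h2 : √2 ^ 2 = (2 : ℝ) := Real.sq_sqrt (by norm_num)
  have h20 : 0 ≤ √2 := Real.sqrt_nonneg 2
  have h0 : 1 + t ^ 3 ≠ 0 := by rcases ht with h | h <;> nlinarith
  have hpos : 0 < (1 + t ^ 3) ^ 2 := by positivity
  rw [abs_lt, lt_div_iff₀ hpos, div_lt_iff₀ hpos]
  generalize t ^ 3 = r at *
  rcases ht with h | h
  · constructor <;> nlinarith [mul_pos (sub_pos.2 h) (sub_pos.2 h)]
  · constructor
    · nlinarith [mul_pos (sub_pos.2 h) (sub_pos.2 h),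
        mul_nonneg h20 (sub_pos.2 h).le]
    · nlinarith

theorem one_lt_or_lt_neg_one_of_cube {t : ℝ} (ht : 1 < t ^ 3 ∨ t ^ 3 < -(√2 + 1) ^ 2) :
    1 < t ∨ t < -1 := by
  refine ht.imp (fun h => ?_) (fun h => ?_)
  · nlinarith [sq_nonneg (t + 1), sq_nonneg t]
  · have : t ^ 3 < -1 := by nlinarith [Real.sqrt_nonneg 2]
    nlinarith [sq_nonneg (t - 1), sq_nonneg t]

theorem mainTheorem3 (x y : ℝ)
    (hxy : 1 < x / y ∨ x / y < -(Real.sqrt 2 + 1) ^ 2) :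
    HasSum
      (fun k : ℕ =>
        (27 * x * y) ^ (k + 1) /
          ((x + y) ^ (2 * (k + 1)) * ((3 * (k + 1)).choose (k + 1) : ℝ)))
      (4 * x * y / (x - y) ^ 2 +
        cbrt (x * y) / 3 * ((x + y) / (x - y) ^ 3) *
          (2 * Real.sqrt 3 *
              (2 * cbrt (x * y) * (cbrt (x ^ 2) + cbrt (y ^ 2)) +
                cbrt (x ^ 4) + cbrt (y ^ 4)) *
              Real.arctan (Real.sqrt 3 * cbrt y / (2 * cbrt x - cbrt y)) -
            (2 * cbrt (x * y) * (cbrt (x ^ 2) - cbrt (y ^ 2)) -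
                cbrt (x ^ 4) + cbrt (y ^ 4)) *
              Real.log ((x + y) / (cbrt x + cbrt y) ^ 3))) := by
  -- Since `x / 0 = 0`, neither alternative of `hxy` can hold at y = 0.
  have hb : y ≠ 0 := by
    rintro rfl
    rw [div_zero] at hxy
    rcases hxy with h | h <;> nlinarith [sq_nonneg (√2 + 1)]
  have hbc : cbrt y ≠ 0 := fun h => hb (by rw [← cbrt_pow_three y, h]; norm_num)
  obtain ⟨t, ht⟩ : ∃ t, cbrt x = t * cbrt y := ⟨cbrt x / cbrt y, by field_simp⟩
  have hx : x = t ^ 3 * cbrt y ^ 3 := by rw [← mul_pow, ← ht, cbrt_pow_three]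
  have hy : y = cbrt y ^ 3 := (cbrt_pow_three y).symm
  have c1 : cbrt (x * y) = cbrt x * cbrt y :=
    ((eq_cbrt_iff _ _).2 (by rw [mul_pow, cbrt_pow_three, cbrt_pow_three])).symm
  have c2 (w : ℝ) (n : ℕ) : cbrt (w ^ n) = cbrt w ^ n :=
    ((eq_cbrt_iff _ _).2 (by rw [← pow_mul, mul_comm, pow_mul, cbrt_pow_three])).symm
  rw [c1, c2, c2, c2, c2, ht]
  generalize cbrt y = b at *
  subst hx hy
  rw [mul_div_cancel_right₀ _ hb] at hxy
  have ht' := one_lt_or_lt_neg_one_of_cube hxy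
  have h := hasSum_pow_div_choose (abs_lt_of_cube hxy)
  rw [integral_eq ht'] at h
  have hq : 0 < t ^ 2 - t + 1 := by nlinarith [sq_nonneg (t - 1)]
  have hq' : 0 < t ^ 2 + t + 1 := by nlinarith [sq_nonneg (t + 1)]
  have hp : t + 1 ≠ 0 := by rcases ht' with h | h <;> linarith
  have hm : t - 1 ≠ 0 := by rcases ht' with h | h <;> linarith
  have hp3 : 1 + t ^ 3 ≠ 0 := by
    rw [show 1 + t ^ 3 = (t + 1) * (t ^ 2 - t + 1) by ring]; positivity
  have hm3 : t ^ 3 - 1 ≠ 0 := by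
    rw [show t ^ 3 - 1 = (t - 1) * (t ^ 2 + t + 1) by ring]; positivity
  have s1 : t ^ 3 * b ^ 3 + b ^ 3 = (t ^ 3 + 1) * b ^ 3 := by ring
  have s2 : t ^ 3 * b ^ 3 - b ^ 3 = (t ^ 3 - 1) * b ^ 3 := by ring
  have s3 : √3 * b / (2 * (t * b) - b) = √3 / (2 * t - 1) := by
    rw [show 2 * (t * b) - b = (2 * t - 1) * b by ring, mul_div_mul_right _ _ hbc]
  have s4 : (t ^ 3 + 1) * b ^ 3 / (t * b + b) ^ 3 = (t ^ 3 + 1) / (t + 1) ^ 3 := by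
    rw [show (t * b + b) ^ 3 = (t + 1) ^ 3 * b ^ 3 by ring, mul_div_mul_right _ _ hb]
  rw [s1, s2, s3, s4]
  -- All powers of b cancel by homogeneity; the logarithm's coefficient is (t-1)³(t+1) =
  -- t⁴-2t³+2t-1.
  have hv : 4 * (t ^ 3 * b ^ 3) * b ^ 3 / ((t ^ 3 - 1) * b ^ 3) ^ 2 +
      t * b * b / 3 * ((t ^ 3 + 1) * b ^ 3 / ((t ^ 3 - 1) * b ^ 3) ^ 3) *
        (2 * √3 * (2 * (t * b * b) * ((t * b) ^ 2 + b ^ 2) + (t * b) ^ 4 + b ^ 4) *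
            Real.arctan (√3 / (2 * t - 1)) -
          (2 * (t * b * b) * ((t * b) ^ 2 - b ^ 2) - (t * b) ^ 4 + b ^ 4) *
            Real.log ((t ^ 3 + 1) / (t + 1) ^ 3)) =
      4 * t ^ 3 / (t ^ 3 - 1) ^ 2 + t / 3 * ((t ^ 3 + 1) / (t ^ 3 - 1) ^ 3) *
        (2 * √3 * (t ^ 4 + 2 * t ^ 3 + 2 * t + 1) * Real.arctan (√3 / (2 * t - 1)) +
          (t - 1) ^ 3 * (t + 1) * Real.log ((t ^ 3 + 1) / (t + 1) ^ 3)) := by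
    field_simp
    ring
  rw [hv]
  convert! h using 1
  ext k
  have e : 27 * t ^ 3 / (1 + t ^ 3) ^ 2 =
      27 * (t ^ 3 * b ^ 3) * b ^ 3 / ((t ^ 3 + 1) * b ^ 3) ^ 2 := by
    rw [add_comm 1 (t ^ 3)] at *
    field_simp
  rw [e, div_pow, ← pow_mul, div_div]
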